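/- All objects are smooth ($C^\infty$). Let $L$ be a smooth manifold. A \emph{Levi flat structure} on $L$ is a pair $(\xi,J)$, where $\xi\subset T(L)$ is an integrable distribution of codimension $1$ (the space $\mathcal H(\xi)$ of vector fields tangent to $\xi$ is closed under the Lie bracket) and $J$ is a complex structure on the bundle $\xi$ ($J\in\mathrm{End}(\xi)$, $J^2=-I$) which is integrable along the leaves, i.e. $N_J(V,W)=[JV,JW]-[V,W]-J[JV,W]-J[V,JW]$ vanishes for all $V,W\in\mathcal H(\xi)$. Let $(\xi,J)$ be a Levi flat structure on $L$, and let $\gamma$ be a $1$-form and $X$ a vector field on $L$ with $\ker\gamma=\xi$ and $\gamma(X)=1$. For $1$-forms set $\{\alpha,\beta\}=\mathcal L_X\alpha\wedge\beta-\alpha\wedge\mathcal L_X\beta$ and $\delta\alpha=d\alpha+\{\gamma,\alpha\}$. Let $\alpha\in\mathcal Z^1(L)$, i.e. $\alpha$ is a $1$-form with $\alpha(X)=0$, and put $\xi_\alpha=\ker(\gamma+\alpha)$, $\omega_\alpha(V)=V-\alpha(V)X$ (an isomorphism $\xi\to\xi_\alpha$ with inverse $V\mapsto V+\alpha(V)X$)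 and $[V,W]_\alpha=\omega_\alpha^{-1}[\omega_\alpha V,\omega_\alpha W]$. For $V,W\in\mathcal H(\xi)$ set $$N^\alpha_J(V,W)=[JV,JW]_\alpha-[V,W]_\alpha-J[JV,W]_\alpha-J[V,JW]_\alpha,$$ $$(\overline\partial{}^\alpha_J W)(V)=\tfrac12\big([V,W]_\alpha+J[JV,W]_\alpha\big)+\tfrac14N^\alpha_J(V,W),$$ and, for $S\in\Lambda^{0,1}_J(\xi)\otimes\xi$ (i.e. $S\in\mathrm{End}(\xi)$ with $SJ=-JS$), $$\overline\partial{}^\alpha_JS(V,W)=\overline\partial{}^\alpha_J(SW)(V)-\overline\partial{}^\alpha_J(SV)(W)-\tfrac12S\big([V,W]_\alpha-[JV,JW]_\alpha\big),$$ $$[S,S]_\alpha(V,W)=[SV,SW]_\alpha-[JSV,JSW]_\alpha-S\big([SV,W]_\alpha+[V,SW]_\alpha+J[V,JSW]_\alpha+J[JSV,W]_\alpha\big)-\tfrac12\big(SN^\alpha_J(SV,W)+SN^\alpha_J(V,SW)-N^\alpha_J(SV,SW)\big),$$ $$[[S,S]]_\alpha(V,W)=[S,S]_\alpha(V,W)-\tfrac12S\big(N^\alpha_J(V,W)-N^\alpha_J(SV,SW)\big).$$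 Finally let $T(V)=[V,X]-\gamma([V,X])X$, $H(V)=\tfrac12(T(V)+JT(JV))$, $\alpha^{0,1}_J(V)=\tfrac12(\alpha(V)+i\,\alpha(JV))$ for $V\in\mathcal H(\xi)$, and $(\alpha^{0,1}_J\wedge H)(V,W)=\alpha^{0,1}_J(V)H(W)-\alpha^{0,1}_J(W)H(V)$, where $i$ acts on $\xi$ as $J$. Let $J_\alpha$ be a complex structure on $\xi_\alpha$, and let $S_\alpha\in\Lambda^{0,1}_J(\xi)\otimes\xi$ be the (necessarily unique) form such that $I+S_\alpha$ is invertible and $\omega_\alpha^{-1}J_\alpha\omega_\alpha=(I+S_\alpha)J(I+S_\alpha)^{-1}$ on $\xi$ (it is assumed that such a form exists). Then the following are equivalent: 1) $(\xi_\alpha,J_\alpha)$ is a Levi flat structure. 2) $\delta\alpha+\tfrac12\{\alpha,\alpha\}=0$ (which implies $[V,W]_\alpha\in\mathcal H(\xi)$ for $V,W\in\mathcal H(\xi)$, so that the expressions above make sense), and $$\overline\partial{}^\alpha_JS_\alpha+\tfrac12[[S_\alpha,S_\alpha]]_\alpha=\tfrac14N^\alpha_J=-\alpha^{0,1}_J\wedge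 H .$$ -/

import Mathlib

open scoped Manifold ContDiff Topology

noncomputable section

namespace LeviFlat

/-! ## Brackets, Nijenhuis tensor and the operators attached to a complex structure

Here `g` is a real vector space, `br` a bracket on `g`, and `J`, `S` are operators on `g`. -/

section Algebra

variable {g : Type*} [AddCommGroup g] [Module ℝ g]

/-- The Nijenhuis tensor `N(V,W) = [JV,JW] - [V,W] - J[JV,W] - J[V,JW]`. -/
def nijenhuis (br : g → g → g) (J : g → g) (V W : g) : g :=
  br (J V) (J W) - br V W - J (br (J V) W) - J (br V (J W))

/-- `(∂̄ W)(V) = ½ ([V,W] + J[JV,W]) + ¼ N(V,W)`. -/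
def dbar (br : g → g → g) (J : g → g) (W V : g) : g :=
  (1 / 2 : ℝ) • (br V W + J (br (J V) W)) + (1 / 4 : ℝ) • nijenhuis br J V W

/-- `(∂̄ S)(V,W) = ∂̄(SW)(V) - ∂̄(SV)(W) - ½ S([V,W] - [JV,JW])`. -/
def dbarOne (br : g → g → g) (J S : g → g) (V W : g) : g :=
  dbar br J (S W) V - dbar br J (S V) W - (1 / 2 : ℝ) • S (br V W - br (J V) (J W))

/-- The bracket `[S,S]`. -/
def selfBracket (br : g → g → g) (J S : g → g) (V W : g) : g :=
  br (S V) (S W) - br (J (S V)) (J (S W))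
    - S (br (S V) W + br V (S W) + J (br V (J (S W))) + J (br (J (S V)) W))
    - (1 / 2 : ℝ) • (S (nijenhuis br J (S V) W) + S (nijenhuis br J V (S W))
        - nijenhuis br J (S V) (S W))

/-- The modified bracket `[[S,S]] = [S,S] - ½ S (N - N(S,S))`,
where `N(S,S)(V,W) = N(SV,SW)`. -/
def doubleBracket (br : g → g → g) (J S : g → g) (V W : g) : g :=
  selfBracket br J S V W
    - (1 / 2 : ℝ) • S (nijenhuis br J V W - nijenhuis br J (S V) (S W))

end Algebra

/-! ## Vector fields, one-forms and distributions on a smooth manifold -/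

variable {E : Type*} [NormedAddCommGroup E] [NormedSpace ℝ E]
variable {M : Type*} [TopologicalSpace M] [ChartedSpace E M]
  [IsManifold 𝓘(ℝ, E) ∞ M]

/-- A vector field `V` on `M` is smooth. -/
def IsSmoothField (V : ∀ x : M, TangentSpace 𝓘(ℝ, E) x) : Prop :=
  ContMDiff 𝓘(ℝ, E) 𝓘(ℝ, E).tangent ∞
    (fun x => (⟨x, V x⟩ : TangentBundle 𝓘(ℝ, E) M))

/-- A field of covectors on `M` is smooth, i.e. it is a differential one-form. -/
def IsSmoothForm
    (α : ∀ x : M, TangentSpace 𝓘(ℝ, E) x →L[ℝ] ℝ) : Prop :=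
  ContMDiff 𝓘(ℝ, E) (𝓘(ℝ, E).prod 𝓘(ℝ, E →L[ℝ] ℝ)) ∞
    (fun x => Bundle.TotalSpace.mk' (E →L[ℝ] ℝ)
      (E := fun x : M => TangentSpace 𝓘(ℝ, E) x →L[ℝ] Bundle.Trivial M ℝ x) x (α x))

/-- The function `V(f)`, the derivative of the function `f` along the vector field `V`. -/
def dirDeriv (V : ∀ x : M, TangentSpace 𝓘(ℝ, E) x) (f : M → ℝ) (x : M) : ℝ :=
  mfderiv 𝓘(ℝ, E) 𝓘(ℝ, ℝ) f x (V x)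

/-- The Lie bracket of vector fields. -/
abbrev lie (V W : ∀ x : M, TangentSpace 𝓘(ℝ, E) x) : ∀ x : M, TangentSpace 𝓘(ℝ, E) x :=
  VectorField.mlieBracket 𝓘(ℝ, E) V W

/-- The kernel of a field of covectors. -/
def kerForm (β : ∀ x : M, TangentSpace 𝓘(ℝ, E) x →L[ℝ] ℝ) (x : M) :
    Submodule ℝ (TangentSpace 𝓘(ℝ, E) x) :=
  LinearMap.ker (β x).toLinearMap

/-- A smooth distribution of codimension one: locally the kernel of a nowhere vanishing
smooth one-form. -/
def IsCodimOne
    (ξ : ∀ x : M, Submodule ℝ (TangentSpace 𝓘(ℝ, E) x)) : Prop :=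
  ∀ x₀ : M, ∃ β : ∀ x : M, TangentSpace 𝓘(ℝ, E) x →L[ℝ] ℝ,
    IsSmoothForm β ∧ ∀ᶠ x in 𝓝 x₀, β x ≠ 0 ∧ ξ x = kerForm β x

/-- `V` belongs to `𝓗(ξ)`: it is a smooth vector field tangent to `ξ`. -/
def IsSection (ξ : ∀ x : M, Submodule ℝ (TangentSpace 𝓘(ℝ, E) x))
    (V : ∀ x : M, TangentSpace 𝓘(ℝ, E) x) : Prop :=
  IsSmoothField V ∧ ∀ x, V x ∈ ξ x

/-- Integrability of a distribution: `𝓗(ξ)` is closed under the Lie bracket. -/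
def IsIntegrable (ξ : ∀ x : M, Submodule ℝ (TangentSpace 𝓘(ℝ, E) x)) : Prop :=
  ∀ V W : ∀ x : M, TangentSpace 𝓘(ℝ, E) x, IsSection ξ V → IsSection ξ W →
    ∀ x, lie V W x ∈ ξ x

open Classical in
/-- The action of an endomorphism field `A` of `ξ` on vector fields tangent to `ξ`
(with value `0` at the points where the vector field is not tangent to `ξ`). -/
def act (ξ : ∀ x : M, Submodule ℝ (TangentSpace 𝓘(ℝ, E) x))
    (A : ∀ x : M, Module.End ℝ (ξ x)) (V : ∀ x : M, TangentSpace 𝓘(ℝ, E) x) :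
    ∀ x : M, TangentSpace 𝓘(ℝ, E) x :=
  fun x => if h : V x ∈ ξ x then (A x ⟨V x, h⟩ : TangentSpace 𝓘(ℝ, E) x) else 0

/-- An endomorphism field of `ξ` is smooth: it maps `𝓗(ξ)` to `𝓗(ξ)`. -/
def IsSmoothEnd (ξ : ∀ x : M, Submodule ℝ (TangentSpace 𝓘(ℝ, E) x))
    (A : ∀ x : M, Module.End ℝ (ξ x)) : Prop :=
  ∀ V : ∀ x : M, TangentSpace 𝓘(ℝ, E) x, IsSection ξ V → IsSection ξ (act ξ A V)

/-- A complex structure on the bundle `ξ`: a smooth endomorphism field `J` with `J² = -1`. -/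
def IsComplexStructure (ξ : ∀ x : M, Submodule ℝ (TangentSpace 𝓘(ℝ, E) x))
    (J : ∀ x : M, Module.End ℝ (ξ x)) : Prop :=
  IsSmoothEnd ξ J ∧ ∀ x (v : ξ x), J x (J x v) = -v

/-- A Levi flat structure: an integrable distribution `ξ` of codimension one together with
a complex structure `J` on `ξ` which is integrable along the leaves, i.e. whose Nijenhuis
tensor vanishes on vector fields tangent to `ξ`. -/
structure IsLeviFlat
    (ξ : ∀ x : M, Submodule ℝ (TangentSpace 𝓘(ℝ, E) x))
    (J : ∀ x : M, Module.End ℝ (ξ x)) : Prop where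
  codimOne : IsCodimOne ξ
  integrable : IsIntegrable ξ
  complexStructure : IsComplexStructure ξ J
  nijenhuis_eq_zero : ∀ V W : ∀ x : M, TangentSpace 𝓘(ℝ, E) x,
    IsSection ξ V → IsSection ξ W → nijenhuis lie (act ξ J) V W = 0

/-- A DGLA defining couple for `ξ`: a smooth one-form `γ` with kernel `ξ` and a smooth vector
field `X` with `γ(X) = 1`. -/
structure IsDefiningCouple
    (ξ : ∀ x : M, Submodule ℝ (TangentSpace 𝓘(ℝ, E) x))
    (γ : ∀ x : M, TangentSpace 𝓘(ℝ, E) x →L[ℝ] ℝ)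
    (X : ∀ x : M, TangentSpace 𝓘(ℝ, E) x) : Prop where
  smooth_form : IsSmoothForm γ
  smooth_field : IsSmoothField X
  ker_eq : ∀ x, ξ x = kerForm γ x
  apply_eq_one : ∀ x, γ x (X x) = 1

/-- `α ∈ 𝒵¹(M)`: a smooth one-form with `ι_X α = 0`. -/
structure IsZOne
    (X : ∀ x : M, TangentSpace 𝓘(ℝ, E) x)
    (α : ∀ x : M, TangentSpace 𝓘(ℝ, E) x →L[ℝ] ℝ) : Prop where
  smooth : IsSmoothForm α
  apply_eq_zero : ∀ x, α x (X x) = 0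

/-! ## The Maurer–Cartan equation

One-forms and two-forms are evaluated on vector fields. -/

/-- The function `α(V)`. -/
def evalForm (α : ∀ x : M, TangentSpace 𝓘(ℝ, E) x →L[ℝ] ℝ)
    (V : ∀ x : M, TangentSpace 𝓘(ℝ, E) x) (x : M) : ℝ :=
  α x (V x)

/-- The exterior derivative of a one-form: `dα(V,W) = V(α(W)) - W(α(V)) - α([V,W])`. -/
def extDer (α : ∀ x : M, TangentSpace 𝓘(ℝ, E) x →L[ℝ] ℝ)
    (V W : ∀ x : M, TangentSpace 𝓘(ℝ, E) x) (x : M) : ℝ :=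
  dirDeriv V (evalForm α W) x - dirDeriv W (evalForm α V) x - evalForm α (lie V W) x

/-- The Lie derivative of a one-form: `(𝓛_X α)(V) = X(α(V)) - α([X,V])`. -/
def lieDer (X : ∀ x : M, TangentSpace 𝓘(ℝ, E) x)
    (α : ∀ x : M, TangentSpace 𝓘(ℝ, E) x →L[ℝ] ℝ)
    (V : ∀ x : M, TangentSpace 𝓘(ℝ, E) x) (x : M) : ℝ :=
  dirDeriv X (evalForm α V) x - evalForm α (lie X V) x

/-- The wedge product of two one-forms: `(a ∧ b)(V,W) = a(V) b(W) - a(W) b(V)`. -/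
def wedge (a b : (∀ x : M, TangentSpace 𝓘(ℝ, E) x) → M → ℝ)
    (V W : ∀ x : M, TangentSpace 𝓘(ℝ, E) x) (x : M) : ℝ :=
  a V x * b W x - a W x * b V x

/-- The bracket of one-forms: `{α,β} = 𝓛_X α ∧ β - α ∧ 𝓛_X β`. -/
def formBracket (X : ∀ x : M, TangentSpace 𝓘(ℝ, E) x)
    (α β : ∀ x : M, TangentSpace 𝓘(ℝ, E) x →L[ℝ] ℝ)
    (V W : ∀ x : M, TangentSpace 𝓘(ℝ, E) x) (x : M) : ℝ :=
  wedge (lieDer X α) (evalForm β) V W x - wedge (evalForm α) (lieDer X β) V W x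

/-- `δα = dα + {γ,α}`. -/
def delta (γ : ∀ x : M, TangentSpace 𝓘(ℝ, E) x →L[ℝ] ℝ)
    (X : ∀ x : M, TangentSpace 𝓘(ℝ, E) x)
    (α : ∀ x : M, TangentSpace 𝓘(ℝ, E) x →L[ℝ] ℝ)
    (V W : ∀ x : M, TangentSpace 𝓘(ℝ, E) x) (x : M) : ℝ :=
  extDer α V W x + formBracket X γ α V W x

/-- The Maurer–Cartan equation `δα + ½{α,α} = 0`. -/
def MaurerCartan (γ : ∀ x : M, TangentSpace 𝓘(ℝ, E) x →L[ℝ] ℝ)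
    (X : ∀ x : M, TangentSpace 𝓘(ℝ, E) x)
    (α : ∀ x : M, TangentSpace 𝓘(ℝ, E) x →L[ℝ] ℝ) : Prop :=
  ∀ V W : ∀ x : M, TangentSpace 𝓘(ℝ, E) x, IsSmoothField V → IsSmoothField W →
    ∀ x, delta γ X α V W x + 1 / 2 * formBracket X α α V W x = 0

/-! ## The deformed bracket and the deformed complex structure -/

/-- `ω_α(V) = V - α(V) X` at a point. -/
def omega (X : ∀ x : M, TangentSpace 𝓘(ℝ, E) x)
    (α : ∀ x : M, TangentSpace 𝓘(ℝ, E) x →L[ℝ] ℝ) (x : M) (v : TangentSpace 𝓘(ℝ, E) x) :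
    TangentSpace 𝓘(ℝ, E) x :=
  v - α x v • X x

/-- `ω_α⁻¹(V) = V + α(V) X` at a point (the inverse of `ω_α` as soon as `α(X) = 0`). -/
def omegaInv (X : ∀ x : M, TangentSpace 𝓘(ℝ, E) x)
    (α : ∀ x : M, TangentSpace 𝓘(ℝ, E) x →L[ℝ] ℝ) (x : M) (v : TangentSpace 𝓘(ℝ, E) x) :
    TangentSpace 𝓘(ℝ, E) x :=
  v + α x v • X x

/-- The deformed bracket `[V,W]_α = ω_α⁻¹[ω_α V, ω_α W]`. -/
def lieDef (X : ∀ x : M, TangentSpace 𝓘(ℝ, E) x)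
    (α : ∀ x : M, TangentSpace 𝓘(ℝ, E) x →L[ℝ] ℝ)
    (V W : ∀ x : M, TangentSpace 𝓘(ℝ, E) x) : ∀ x : M, TangentSpace 𝓘(ℝ, E) x :=
  fun x => omegaInv X α x
    (lie (fun y => omega X α y (V y)) (fun y => omega X α y (W y)) x)

/-- The distribution `ξ_α = ker(γ + α)`. -/
def xiDef (γ α : ∀ x : M, TangentSpace 𝓘(ℝ, E) x →L[ℝ] ℝ) (x : M) :
    Submodule ℝ (TangentSpace 𝓘(ℝ, E) x) :=
  kerForm (fun y => γ y + α y) x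

/-- The isomorphism `ω_α : ξ → ξ_α`. -/
def omegaEquiv
    {ξ : ∀ x : M, Submodule ℝ (TangentSpace 𝓘(ℝ, E) x)}
    {γ α : ∀ x : M, TangentSpace 𝓘(ℝ, E) x →L[ℝ] ℝ} {X : ∀ x : M, TangentSpace 𝓘(ℝ, E) x}
    (hγ : IsDefiningCouple ξ γ X) (hα : IsZOne X α) (x : M) : ξ x ≃ₗ[ℝ] xiDef γ α x where
  toFun v := ⟨omega X α x v, by
    have hv : γ x v = 0 := by
      have h : (v : TangentSpace 𝓘(ℝ, E) x) ∈ kerForm γ x := (hγ.ker_eq x).le v.2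
      exact h
    change (γ x + α x) (omega X α x v) = 0
    simp [omega, hv, hγ.apply_eq_one x, hα.apply_eq_zero x]⟩
  invFun w := ⟨omegaInv X α x w, by
    have hw : γ x w + α x w = 0 := w.2
    rw [hγ.ker_eq x]
    change γ x (omegaInv X α x w) = 0
    simpa [omegaInv, hγ.apply_eq_one x] using hw⟩
  left_inv v := by
    ext
    simp [omega, omegaInv, hα.apply_eq_zero x]
  right_inv w := by
    ext
    simp [omega, omegaInv, hα.apply_eq_zero x]
  map_add' v w := by
    ext
    simp only [omega, Submodule.coe_add, map_add, add_smul]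
    abel
  map_smul' c v := by
    ext
    simp [omega, smul_sub, mul_smul]

/-- The form `S` belongs to `Λ^{0,1}_J(ξ) ⊗ ξ`: it is smooth and `S(JV) = -J S(V)`. -/
def IsForm01 (ξ : ∀ x : M, Submodule ℝ (TangentSpace 𝓘(ℝ, E) x))
    (J S : ∀ x : M, Module.End ℝ (ξ x)) : Prop :=
  IsSmoothEnd ξ S ∧ ∀ x (v : ξ x), S x (J x v) = -J x (S x v)

/-- The form `S ∈ Λ^{0,1}_J(ξ) ⊗ ξ` encodes the complex structure `Jα` of `ξ_α`: `I + S` is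
invertible and `ω_α⁻¹ Jα ω_α = (I + S) J (I + S)⁻¹`. -/
structure Encodes
    {ξ : ∀ x : M, Submodule ℝ (TangentSpace 𝓘(ℝ, E) x)}
    {γ α : ∀ x : M, TangentSpace 𝓘(ℝ, E) x →L[ℝ] ℝ} {X : ∀ x : M, TangentSpace 𝓘(ℝ, E) x}
    (hγ : IsDefiningCouple ξ γ X) (hα : IsZOne X α)
    (J : ∀ x : M, Module.End ℝ (ξ x)) (Jα : ∀ x : M, Module.End ℝ (xiDef γ α x))
    (S : ∀ x : M, Module.End ℝ (ξ x)) : Prop where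
  form01 : IsForm01 ξ J S
  isUnit : ∀ x, IsUnit (1 + S x)
  conj_eq : ∀ x, (omegaEquiv hγ hα x).symm.conj (Jα x) =
    (1 + S x) * J x * Ring.inverse (1 + S x)

/-- A complex structure `K` is of the form `(I + S) J (I + S)⁻¹` for at most one `S`
that anticommutes with `J`. -/
theorem conj_unique {V : Type*} [AddCommGroup V] [Module ℝ V] {J K S S' : Module.End ℝ V}
    (hJ : ∀ v, J (J v) = -v)
    (hS : ∀ v, S (J v) = -J (S v)) (uS : IsUnit (1 + S))
    (eS : K = (1 + S) * J * Ring.inverse (1 + S))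
    (hS' : ∀ v, S' (J v) = -J (S' v)) (uS' : IsUnit (1 + S'))
    (eS' : K = (1 + S') * J * Ring.inverse (1 + S')) : S = S' := by
  have key : ∀ {R : Module.End ℝ V}, (∀ v, R (J v) = -J (R v)) → IsUnit (1 + R) →
      K = (1 + R) * J * Ring.inverse (1 + R) → (K + J) * (1 + R) = 2 * J := by
    intro R hR uR eR
    have h0 : R * J = -(J * R) := LinearMap.ext hR
    have h1 : K * (1 + R) = (1 + R) * J := by
      rw [eR, mul_assoc, Ring.inverse_mul_cancel _ uR, mul_one]
    rw [add_mul, h1, add_mul, h0, mul_add, one_mul, mul_one, two_mul]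
    abel
  have hJJ : J * J = -1 := LinearMap.ext hJ
  have hJu : IsUnit J :=
    ⟨⟨J, -J, by rw [mul_neg, hJJ, neg_neg], by rw [neg_mul, hJJ, neg_neg]⟩, rfl⟩
  have h2 : IsUnit ((2 : Module.End ℝ V) * J) := by
    refine IsUnit.mul ?_ hJu
    have : (2 : Module.End ℝ V) = algebraMap ℝ (Module.End ℝ V) 2 := by
      rw [map_ofNat]
    rw [this]
    exact (IsUnit.mk0 (2 : ℝ) two_ne_zero).map _
  have h3 : IsUnit (K + J) := by
    rw [← key hS uS eS] at h2
    obtain ⟨u, hu⟩ := uS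
    rw [← hu] at h2
    exact (Units.isUnit_mul_units _ u).1 h2
  have e : (K + J) * (1 + S) = (K + J) * (1 + S') := by
    rw [key hS uS eS, key hS' uS' eS']
  exact add_left_cancel (h3.mul_left_cancel e)

/-- A complex structure of `ξ_α` is encoded by at most one form. -/
theorem Encodes.unique
    {ξ : ∀ x : M, Submodule ℝ (TangentSpace 𝓘(ℝ, E) x)}
    {γ α : ∀ x : M, TangentSpace 𝓘(ℝ, E) x →L[ℝ] ℝ} {X : ∀ x : M, TangentSpace 𝓘(ℝ, E) x}
    {hγ : IsDefiningCouple ξ γ X} {hα : IsZOne X α}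
    {J : ∀ x : M, Module.End ℝ (ξ x)} {Jα : ∀ x : M, Module.End ℝ (xiDef γ α x)}
    (hJ : IsComplexStructure ξ J) {S S' : ∀ x : M, Module.End ℝ (ξ x)}
    (h : Encodes hγ hα J Jα S) (h' : Encodes hγ hα J Jα S') : S = S' := by
  funext x
  exact conj_unique (hJ.2 x) (h.form01.2 x) (h.isUnit x) (h.conj_eq x) (h'.form01.2 x)
    (h'.isUnit x) (h'.conj_eq x)

/-! ## The `(0,1)`-form of a defining couple -/

/-- `T(V) = [V,X] - γ([V,X]) X`. -/
def torsionT (γ : ∀ x : M, TangentSpace 𝓘(ℝ, E) x →L[ℝ] ℝ)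
    (X V : ∀ x : M, TangentSpace 𝓘(ℝ, E) x) : ∀ x : M, TangentSpace 𝓘(ℝ, E) x :=
  fun x => lie V X x - γ x (lie V X x) • X x

/-- `H(V) = ½ (T(V) + J T(JV))`. -/
def formH (ξ : ∀ x : M, Submodule ℝ (TangentSpace 𝓘(ℝ, E) x))
    (J : ∀ x : M, Module.End ℝ (ξ x))
    (γ : ∀ x : M, TangentSpace 𝓘(ℝ, E) x →L[ℝ] ℝ)
    (X V : ∀ x : M, TangentSpace 𝓘(ℝ, E) x) : ∀ x : M, TangentSpace 𝓘(ℝ, E) x :=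
  (1 / 2 : ℝ) • (torsionT γ X V + act ξ J (torsionT γ X (act ξ J V)))

/-- The complex valued form `α^{0,1}(V) = ½ (α(V) + i α(JV))`. -/
def part01 (ξ : ∀ x : M, Submodule ℝ (TangentSpace 𝓘(ℝ, E) x))
    (J : ∀ x : M, Module.End ℝ (ξ x))
    (α : ∀ x : M, TangentSpace 𝓘(ℝ, E) x →L[ℝ] ℝ)
    (V : ∀ x : M, TangentSpace 𝓘(ℝ, E) x) (x : M) : ℂ :=
  1 / 2 * ((evalForm α V x : ℂ) + Complex.I * (evalForm α (act ξ J V) x : ℂ))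

/-- Multiplication of a vector field tangent to `ξ` by a complex function, with `i` acting
on `ξ` as `J`. -/
def cmul (ξ : ∀ x : M, Submodule ℝ (TangentSpace 𝓘(ℝ, E) x))
    (J : ∀ x : M, Module.End ℝ (ξ x)) (z : M → ℂ)
    (Z : ∀ x : M, TangentSpace 𝓘(ℝ, E) x) : ∀ x : M, TangentSpace 𝓘(ℝ, E) x :=
  fun x => (z x).re • Z x + (z x).im • act ξ J Z x

/-- `(α^{0,1} ∧ H)(V,W) = α^{0,1}(V) H(W) - α^{0,1}(W) H(V)`. -/
def wedgeH (ξ : ∀ x : M, Submodule ℝ (TangentSpace 𝓘(ℝ, E) x))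
    (J : ∀ x : M, Module.End ℝ (ξ x))
    (γ : ∀ x : M, TangentSpace 𝓘(ℝ, E) x →L[ℝ] ℝ)
    (X : ∀ x : M, TangentSpace 𝓘(ℝ, E) x)
    (α : ∀ x : M, TangentSpace 𝓘(ℝ, E) x →L[ℝ] ℝ)
    (V W : ∀ x : M, TangentSpace 𝓘(ℝ, E) x) : ∀ x : M, TangentSpace 𝓘(ℝ, E) x :=
  cmul ξ J (part01 ξ J α V) (formH ξ J γ X W) - cmul ξ J (part01 ξ J α W) (formH ξ J γ X V)

end LeviFlat

end

/-! Put `F(β) = dβ + 𝓛_X β ∧ β` for a one-form `β` with `β(X) = 1`. Then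
`F(β)(V,W) = -β([V - β(V)X, W - β(W)X])`, so `ker β` is integrable if and only if `F(β) = 0`;
since `δα + ½{α,α} = F(γ + α) - F(γ)` and `F(γ) = 0`, the Maurer–Cartan equation says that `ξ_α` is
integrable.

The isomorphism `ω_α` turns `(𝓗(ξ_α), [·,·], J_α)` into `(𝓗(ξ), [·,·]_α, K)` with
`K = (1 + S) J (1 + S)⁻¹`. For any alternating bracket,
`(1 - S) N_K((1 + S)V, (1 + S)W) = -4 (∂̄S + ½[[S,S]] - ¼N_J)(V,W)`, and `1 ± S` are both
invertible. On smooth sections the surjectivity of `1 + S` comes from `(1 + S)⁻¹ = ½ (1 - J K)`,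
which is smooth because `J` and `K` are.

Finally `[V,W]_α = [V,W] - α(W) T(V) + α(V) T(W)`, whence `N^α_J = N_J - 4 α^{0,1} ∧ H`, and `N_J`
vanishes. -/

noncomputable section

namespace LeviFlat

theorem map_nijenhuis {g g' F : Type*} [AddCommGroup g] [AddCommGroup g'] [FunLike F g g']
    [AddMonoidHomClass F g g'] (f : F) {br : g → g → g} {br' : g' → g' → g'} {J : g → g}
    {J' : g' → g'} (hbr : ∀ V W, f (br V W) = br' (f V) (f W)) (hJ : ∀ V, f (J V) = J' (f V))
    (V W : g) : f (nijenhuis br J V W) = nijenhuis br' J' (f V) (f W) := by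
  simp only [nijenhuis, map_sub, hbr, hJ]

/-- `K` is the deformation `(1 + S) J (1 + S)⁻¹` of the complex structure `J` along an element `S`
of type `(0,1)`. The ring is meant to be one of endomorphisms of a bundle or of its space of
sections, and the conjugation is written without the inverse so that it transfers along ring
homomorphisms. -/
structure IsDeformation {R : Type*} [Ring R] (J S K : R) : Prop where
  mul_self : J * J = -1
  anticomm : S * J = -(J * S)
  isUnit_one_add : IsUnit (1 + S)
  conj : K * (1 + S) = (1 + S) * J

namespace IsDeformation

section Ring

variable {R R' : Type*} [Ring R] [Ring R'] {J S K : R}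

theorem map (h : IsDeformation J S K) (f : R →+* R') : IsDeformation (f J) (f S) (f K) where
  mul_self := by rw [← map_mul, h.mul_self, map_neg, map_one]
  anticomm := by rw [← map_mul, h.anticomm, map_neg, map_mul]
  isUnit_one_add := by simpa only [map_add, map_one] using h.isUnit_one_add.map f
  conj := by simpa only [map_mul, map_add, map_one] using congrArg f h.conj

theorem one_sub_mul_one_add (h : IsDeformation J S K) : (1 - J * K) * (1 + S) = 2 := by
  have hJSJ : J * S * J = S := by
    rw [mul_assoc, h.anticomm, mul_neg, ← mul_assoc, h.mul_self, neg_one_mul, neg_neg]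
  calc (1 - J * K) * (1 + S) = 1 + S - J * (K * (1 + S)) := by noncomm_ring
    _ = 1 + S - (J * J + J * S * J) := by rw [h.conj]; noncomm_ring
    _ = 2 := by rw [h.mul_self, hJSJ, ← one_add_one_eq_two]; abel

theorem one_add_mul_one_sub (h : IsDeformation J S K) : (1 + S) * (1 - J * K) = 2 := by
  refine h.isUnit_one_add.mul_right_cancel ?_
  rw [mul_assoc, h.one_sub_mul_one_add, mul_two, two_mul]

theorem of_map_injective {f : R →+* R'} (hf : Function.Injective f) (h2 : IsUnit (2 : R))
    (h : IsDeformation (f J) (f S) (f K)) : IsDeformation J S K where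
  mul_self := hf (by simpa using h.mul_self)
  anticomm := hf (by simpa using h.anticomm)
  isUnit_one_add := by
    have right_inv : (1 + S) * (1 - J * K) = 2 :=
      hf (by simpa [map_ofNat f 2] using h.one_add_mul_one_sub)
    have left_inv : (1 - J * K) * (1 + S) = 2 :=
      hf (by simpa [map_ofNat f 2] using h.one_sub_mul_one_add)
    have comm : Commute (1 + S) (1 - J * K) := right_inv.trans left_inv.symm
    exact (comm.isUnit_mul_iff.1 (right_inv ▸ h2)).1
  conj := hf (by simpa using h.conj)

theorem isUnit_one_sub (h : IsDeformation J S K) : IsUnit (1 - S) := by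
  have hJ : IsUnit J := ⟨⟨J, -J, by rw [mul_neg, h.mul_self, neg_neg],
    by rw [neg_mul, h.mul_self, neg_neg]⟩, rfl⟩
  have conj_one_add : J * (1 + S) * J = -(1 - S) := by
    rw [mul_assoc, add_mul, one_mul, h.anticomm, mul_add, mul_neg, ← mul_assoc, h.mul_self]
    noncomm_ring
  rw [← IsUnit.neg_iff, ← conj_one_add]
  exact (hJ.mul h.isUnit_one_add).mul hJ

theorem one_sub_mul (h : IsDeformation J S K) : (1 - S) * K = (1 + S) * J := by
  have one_sub_mul_J : (1 - S) * J = J * (1 + S) := by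
    rw [sub_mul, h.anticomm]
    noncomm_ring
  refine h.isUnit_one_add.mul_right_cancel ?_
  calc (1 - S) * K * (1 + S) = (1 + S) * ((1 - S) * J) := by
        rw [mul_assoc, h.conj]
        noncomm_ring
    _ = (1 + S) * J * (1 + S) := by rw [one_sub_mul_J, mul_assoc]

end Ring

section Nijenhuis

variable {g : Type*} [AddCommGroup g] [Module ℝ g] {br : g →ₗ[ℝ] g →ₗ[ℝ] g} {J S K : Module.End ℝ g}

theorem one_sub_nijenhuis (h : IsDeformation J S K) (hbr : br.IsAlt) (V W : g) :
    (1 - S) (nijenhuis (br · ·) K ((1 + S) V) ((1 + S) W)) =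
      (-4 : ℝ) • (dbarOne (br · ·) J S V W + (1 / 2 : ℝ) • doubleBracket (br · ·) J S V W
        - (1 / 4 : ℝ) • nijenhuis (br · ·) J V W) := by
  have anticomm : ∀ v, S (J v) = -J (S v) := LinearMap.congr_fun h.anticomm
  have conj : ∀ v, K ((1 + S) v) = (1 + S) (J v) := LinearMap.congr_fun h.conj
  have one_sub_K : ∀ v, (1 - S) (K v) = (1 + S) (J v) := LinearMap.congr_fun h.one_sub_mul
  simp only [nijenhuis, conj, map_sub (1 - S), one_sub_K]
  simp only [dbarOne, doubleBracket, selfBracket, dbar, nijenhuis, LinearMap.add_apply,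
    LinearMap.sub_apply, Module.End.one_apply]
  rw [← hbr.neg (S V) W, ← hbr.neg (S V) (J W), ← hbr.neg (J (S V)) (J W), ← hbr.neg (J (S V)) W]
  simp only [map_add, map_sub, map_neg, LinearMap.add_apply, LinearMap.neg_apply, anticomm]
  module

theorem nijenhuis_eq_zero_iff (h : IsDeformation J S K) (hbr : br.IsAlt) :
    (∀ V W, nijenhuis (br · ·) K V W = 0) ↔
      ∀ V W, dbarOne (br · ·) J S V W + (1 / 2 : ℝ) • doubleBracket (br · ·) J S V W
        = (1 / 4 : ℝ) • nijenhuis (br · ·) J V W := by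
  have one_sub_injective : Function.Injective ⇑(1 - S) :=
    ((Module.End.isUnit_iff _).1 h.isUnit_one_sub).1
  have one_add_surjective : Function.Surjective ⇑(1 + S) :=
    ((Module.End.isUnit_iff _).1 h.isUnit_one_add).2
  rw [one_add_surjective.forall₂]
  refine forall₂_congr fun V W => ?_
  rw [← map_eq_zero_iff _ one_sub_injective, h.one_sub_nijenhuis hbr,
    smul_eq_zero_iff_right (by norm_num), sub_eq_zero]

end Nijenhuis

end IsDeformation

section Pointwise

variable {E : Type*} [NormedAddCommGroup E] [NormedSpace ℝ E]
variable {M : Type*} [TopologicalSpace M] [ChartedSpace E M]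

theorem dirDeriv_add (V : ∀ x : M, TangentSpace 𝓘(ℝ, E) x) {f h : M → ℝ} {x : M}
    (hf : MDifferentiableAt 𝓘(ℝ, E) 𝓘(ℝ, ℝ) f x) (hh : MDifferentiableAt 𝓘(ℝ, E) 𝓘(ℝ, ℝ) h x) :
    dirDeriv V (f + h) x = dirDeriv V f x + dirDeriv V h x := by
  rw [dirDeriv, mfderiv_add hf hh]
  rfl

theorem dirDeriv_sub_smul (V X : ∀ x : M, TangentSpace 𝓘(ℝ, E) x) (f h : M → ℝ) (x : M) :
    dirDeriv (V - f • X) h x = dirDeriv V h x - f x * dirDeriv X h x := by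
  change mfderiv 𝓘(ℝ, E) 𝓘(ℝ, ℝ) h x (V x - f x • X x) = _
  rw [map_sub, map_smul]
  rfl

section Act

variable {ξ : ∀ x : M, Submodule ℝ (TangentSpace 𝓘(ℝ, E) x)}
  {V W : ∀ x : M, TangentSpace 𝓘(ℝ, E) x}

theorem act_apply (A : ∀ x : M, Module.End ℝ (ξ x)) {x : M} (h : V x ∈ ξ x) :
    act ξ A V x = A x ⟨V x, h⟩ :=
  dif_pos h

theorem act_mem (A : ∀ x : M, Module.End ℝ (ξ x)) (hV : ∀ x, V x ∈ ξ x) (x : M) :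
    act ξ A V x ∈ ξ x := by
  rw [act_apply A (hV x)]
  exact Subtype.property _

theorem act_add (A : ∀ x : M, Module.End ℝ (ξ x)) (hV : ∀ x, V x ∈ ξ x) (hW : ∀ x, W x ∈ ξ x) :
    act ξ A (V + W) = act ξ A V + act ξ A W := by
  funext x
  rw [Pi.add_apply, act_apply A (hV x), act_apply A (hW x), ← Submodule.coe_add, ← map_add]
  exact act_apply A ((ξ x).add_mem (hV x) (hW x))

theorem act_sub (A : ∀ x : M, Module.End ℝ (ξ x)) (hV : ∀ x, V x ∈ ξ x) (hW : ∀ x, W x ∈ ξ x) :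
    act ξ A (V - W) = act ξ A V - act ξ A W := by
  have hVW : ∀ x, (V - W) x ∈ ξ x := fun x => (ξ x).sub_mem (hV x) (hW x)
  rw [eq_sub_iff_add_eq, ← act_add A hVW hW, sub_add_cancel]

theorem act_smul (A : ∀ x : M, Module.End ℝ (ξ x)) (f : M → ℝ) (hV : ∀ x, V x ∈ ξ x) :
    act ξ A (f • V) = f • act ξ A V := by
  funext x
  rw [Pi.smul_apply', act_apply A (hV x), ← Submodule.coe_smul, ← map_smul]
  exact act_apply A ((ξ x).smul_mem (f x) (hV x))

theorem act_add_end (A B : ∀ x : M, Module.End ℝ (ξ x)) (hV : ∀ x, V x ∈ ξ x) :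
    act ξ (A + B) V = act ξ A V + act ξ B V := by
  funext x
  rw [Pi.add_apply, act_apply A (hV x), act_apply B (hV x), act_apply (A + B) (hV x)]
  rfl

theorem act_mul (A B : ∀ x : M, Module.End ℝ (ξ x)) (hV : ∀ x, V x ∈ ξ x) :
    act ξ (A * B) V = act ξ A (act ξ B V) := by
  funext x
  rw [act_apply A (act_mem B hV x), act_apply (A * B) (hV x)]
  exact congrArg (fun v => (A x v : TangentSpace 𝓘(ℝ, E) x)) (Subtype.ext (act_apply B (hV x)).symm)

theorem act_one (hV : ∀ x, V x ∈ ξ x) : act ξ 1 V = V :=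
  funext fun x => act_apply 1 (hV x)

theorem act_smul_end (c : ℝ) (A : ∀ x : M, Module.End ℝ (ξ x)) (hV : ∀ x, V x ∈ ξ x) :
    act ξ (c • A) V = c • act ξ A V := by
  funext x
  rw [Pi.smul_apply, act_apply A (hV x), act_apply (c • A) (hV x)]
  rfl

theorem act_act_of_sq_eq_neg_one {J : ∀ x : M, Module.End ℝ (ξ x)}
    (hJ : ∀ x (v : ξ x), J x (J x v) = -v) (hV : ∀ x, V x ∈ ξ x) :
    act ξ J (act ξ J V) = -V := by
  funext x
  rw [← act_mul J J hV, act_apply (J * J) (hV x)]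
  exact congrArg Subtype.val (hJ x ⟨V x, hV x⟩)

end Act

end Pointwise

section Smooth

variable {E : Type*} [NormedAddCommGroup E] [NormedSpace ℝ E]
variable {M : Type*} [TopologicalSpace M] [ChartedSpace E M] [IsManifold 𝓘(ℝ, E) ∞ M]
variable {V W X : ∀ x : M, TangentSpace 𝓘(ℝ, E) x}
  {α β : ∀ x : M, TangentSpace 𝓘(ℝ, E) x →L[ℝ] ℝ} {f h : M → ℝ}

theorem isSmoothField_zero : IsSmoothField (0 : ∀ x : M, TangentSpace 𝓘(ℝ, E) x) :=
  Bundle.contMDiff_zeroSection ℝ _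

theorem IsSmoothField.add (hV : IsSmoothField V) (hW : IsSmoothField W) :
    IsSmoothField (V + W) :=
  ContMDiff.add_section hV hW

theorem IsSmoothField.sub (hV : IsSmoothField V) (hW : IsSmoothField W) :
    IsSmoothField (V - W) :=
  ContMDiff.sub_section hV hW

theorem IsSmoothField.smul (hf : ContMDiff 𝓘(ℝ, E) 𝓘(ℝ, ℝ) ∞ f) (hV : IsSmoothField V) :
    IsSmoothField (f • V) :=
  ContMDiff.smul_section hf hV

theorem IsSmoothField.const_smul (c : ℝ) (hV : IsSmoothField V) : IsSmoothField (c • V) :=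
  IsSmoothField.smul (f := fun _ => c) contMDiff_const hV

theorem IsSmoothField.mdifferentiableAt (hV : IsSmoothField V) (x : M) :
    MDiffAt (T% V) x :=
  (hV x).mdifferentiableAt (by simp)

theorem IsSmoothForm.add (hα : IsSmoothForm α) (hβ : IsSmoothForm β) :
    IsSmoothForm (fun x => α x + β x) :=
  ContMDiff.add_section hα hβ

theorem IsSmoothForm.eval (hα : IsSmoothForm α) (hV : IsSmoothField V) :
    ContMDiff 𝓘(ℝ, E) 𝓘(ℝ, ℝ) ∞ (evalForm α V) := by
  have h := ContMDiff.clm_bundle_apply (F₂ := ℝ) (E₂ := Bundle.Trivial M ℝ) hα hV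
  exact fun x => (Bundle.contMDiffAt_section _).1 (h x)

theorem IsSmoothForm.eval_mdifferentiableAt (hα : IsSmoothForm α) (hV : IsSmoothField V) (x : M) :
    MDifferentiableAt 𝓘(ℝ, E) 𝓘(ℝ, ℝ) (evalForm α V) x :=
  (hα.eval hV x).mdifferentiableAt (by simp)

variable [CompleteSpace E]

theorem IsSmoothField.lie (hV : IsSmoothField V) (hW : IsSmoothField W) :
    IsSmoothField (lie V W) := fun x => by
  have : IsManifold 𝓘(ℝ, E) (minSmoothness ℝ 2) M :=
    .of_le (n := ∞) (by rw [minSmoothness_of_isRCLikeNormedField]; norm_cast)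
  have : IsManifold 𝓘(ℝ, E) (((⊤ : ℕ∞) : WithTop ℕ∞) + 1) M := .of_le (n := ∞) (by norm_cast)
  exact ContMDiffAt.mlieBracket_vectorField (m := ⊤) (n := ⊤) (hV x) (hW x) (by simp)

theorem lie_sub_smul_right (V : ∀ x : M, TangentSpace 𝓘(ℝ, E) x) {x : M}
    (hW : MDiffAt (T% W) x) (hX : MDiffAt (T% X) x) (hh : MDiffAt h x) :
    lie V (W - h • X) x = lie V W x - h x • lie V X x - dirDeriv V h x • X x := by
  have : IsManifold 𝓘(ℝ, E) 2 M := .of_le (n := ∞) (by norm_cast)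
  have hhX : MDiffAt (T% (h • X)) x := hh.smul_section hX
  have lie_split :=
    VectorField.mlieBracket_add_right (V := V) (mdifferentiableAt_sub_section hW hhX) hhX
  rw [sub_add_cancel, VectorField.mlieBracket_smul_right hh hX] at lie_split
  rw [sub_sub, add_comm (h x • lie V X x)]
  exact eq_sub_of_add_eq lie_split.symm

theorem lie_sub_smul_left (W : ∀ x : M, TangentSpace 𝓘(ℝ, E) x) {x : M}
    (hV : MDiffAt (T% V) x) (hX : MDiffAt (T% X) x) (hf : MDiffAt f x) :
    lie (V - f • X) W x = lie V W x - f x • lie X W x + dirDeriv W f x • X x := by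
  rw [lie, VectorField.mlieBracket_swap_apply, ← lie, lie_sub_smul_right W hV hX hf, lie, lie,
    VectorField.mlieBracket_swap_apply (V := W) (W := V),
    VectorField.mlieBracket_swap_apply (V := W) (W := X)]
  module

theorem lie_sub_smul_sub_smul {x : M} (hV : MDiffAt (T% V) x) (hW : MDiffAt (T% W) x)
    (hX : MDiffAt (T% X) x) (hf : MDiffAt f x) (hh : MDiffAt h x) :
    lie (V - f • X) (W - h • X) x = lie V W x - h x • lie V X x + f x • lie W X x
      - (dirDeriv V h x - dirDeriv W f x - f x * dirDeriv X h x + h x * dirDeriv X f x)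
        • X x := by
  rw [lie_sub_smul_right _ hW hX hh, lie_sub_smul_left _ hV hX hf, lie_sub_smul_left _ hV hX hf,
    dirDeriv_sub_smul, lie, lie, lie, lie, VectorField.mlieBracket_swap_apply (V := X) (W := W),
    VectorField.mlieBracket_self]
  simp only [Pi.zero_apply]
  module

end Smooth

section MaurerCartan

variable {E : Type*} [NormedAddCommGroup E] [NormedSpace ℝ E]
variable {M : Type*} [TopologicalSpace M] [ChartedSpace E M] [IsManifold 𝓘(ℝ, E) ∞ M]
variable {V W X : ∀ x : M, TangentSpace 𝓘(ℝ, E) x}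
  {ξ : ∀ x : M, Submodule ℝ (TangentSpace 𝓘(ℝ, E) x)}
  {α β γ : ∀ x : M, TangentSpace 𝓘(ℝ, E) x →L[ℝ] ℝ}

/-- The two-form `F(β) = dβ + 𝓛_X β ∧ β`, which for `β(X) = 1` is the obstruction to the
integrability of `ker β`. -/
def frobeniusForm (X : ∀ x : M, TangentSpace 𝓘(ℝ, E) x)
    (β : ∀ x : M, TangentSpace 𝓘(ℝ, E) x →L[ℝ] ℝ)
    (V W : ∀ x : M, TangentSpace 𝓘(ℝ, E) x) (x : M) : ℝ :=
  extDer β V W x + wedge (lieDer X β) (evalForm β) V W x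

theorem extDer_add (hα : IsSmoothForm α) (hβ : IsSmoothForm β)
    (hV : IsSmoothField V) (hW : IsSmoothField W) (x : M) :
    extDer (fun x => α x + β x) V W x = extDer α V W x + extDer β V W x := by
  change dirDeriv V (evalForm α W + evalForm β W) x - dirDeriv W (evalForm α V + evalForm β V) x
    - (α x (lie V W x) + β x (lie V W x)) = _
  rw [dirDeriv_add V (hα.eval_mdifferentiableAt hW x) (hβ.eval_mdifferentiableAt hW x),
    dirDeriv_add W (hα.eval_mdifferentiableAt hV x) (hβ.eval_mdifferentiableAt hV x)]
  simp only [extDer, evalForm]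
  ring

theorem lieDer_add (X : ∀ x : M, TangentSpace 𝓘(ℝ, E) x) (hα : IsSmoothForm α)
    (hβ : IsSmoothForm β) (hV : IsSmoothField V) (x : M) :
    lieDer X (fun x => α x + β x) V x = lieDer X α V x + lieDer X β V x := by
  change dirDeriv X (evalForm α V + evalForm β V) x - (α x (lie X V x) + β x (lie X V x)) = _
  rw [dirDeriv_add X (hα.eval_mdifferentiableAt hV x) (hβ.eval_mdifferentiableAt hV x)]
  simp only [lieDer, evalForm]
  ring

theorem delta_add_half_formBracket (X : ∀ x : M, TangentSpace 𝓘(ℝ, E) x) (hγ : IsSmoothForm γ)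
    (hα : IsSmoothForm α) (hV : IsSmoothField V) (hW : IsSmoothField W) (x : M) :
    delta γ X α V W x + 1 / 2 * formBracket X α α V W x =
      frobeniusForm X (fun x => γ x + α x) V W x - frobeniusForm X γ V W x := by
  simp only [frobeniusForm, extDer_add hγ hα hV hW, wedge, lieDer_add X hγ hα hV,
    lieDer_add X hγ hα hW, delta, formBracket, evalForm, add_apply]
  ring

namespace IsDefiningCouple

theorem apply_eq_zero_of_mem (hβ : IsDefiningCouple ξ β X) {x : M} {v : TangentSpace 𝓘(ℝ, E) x}
    (hv : v ∈ ξ x) : β x v = 0 :=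
  (hβ.ker_eq x).le hv

theorem sub_smul_mem (hβ : IsDefiningCouple ξ β X) (x : M) (v : TangentSpace 𝓘(ℝ, E) x) :
    v - β x v • X x ∈ ξ x := by
  rw [hβ.ker_eq x]
  change β x (v - β x v • X x) = 0
  rw [map_sub, map_smul, hβ.apply_eq_one, smul_eq_mul, mul_one, sub_self]

theorem isSection_sub_smul (hβ : IsDefiningCouple ξ β X) (hV : IsSmoothField V) :
    IsSection ξ (V - evalForm β V • X) :=
  ⟨hV.sub (hβ.smooth_field.smul (hβ.smooth_form.eval hV)), fun x => hβ.sub_smul_mem x (V x)⟩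

theorem sub_smul_eq_self (hβ : IsDefiningCouple ξ β X) (hV : ∀ x, V x ∈ ξ x) :
    V - evalForm β V • X = V := by
  funext x
  change V x - β x (V x) • X x = V x
  rw [hβ.apply_eq_zero_of_mem (hV x), zero_smul, sub_zero]

theorem isCodimOne (hβ : IsDefiningCouple ξ β X) : IsCodimOne ξ := fun _ =>
  ⟨β, hβ.smooth_form, .of_forall fun x =>
    ⟨fun h => zero_ne_one ((DFunLike.congr_fun h (X x)).symm.trans (hβ.apply_eq_one x)),
      hβ.ker_eq x⟩⟩

theorem xiDef (hγ : IsDefiningCouple ξ γ X) (hα : IsZOne X α) :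
    IsDefiningCouple (xiDef γ α) (fun x => γ x + α x) X where
  smooth_form := hγ.smooth_form.add hα.smooth
  smooth_field := hγ.smooth_field
  ker_eq _ := rfl
  apply_eq_one x := by rw [add_apply, hγ.apply_eq_one, hα.apply_eq_zero, add_zero]

variable [CompleteSpace E]

theorem frobeniusForm_eq (hβ : IsDefiningCouple ξ β X) (hV : IsSmoothField V)
    (hW : IsSmoothField W) (x : M) :
    frobeniusForm X β V W x =
      -β x (lie (V - evalForm β V • X) (W - evalForm β W • X) x) := by
  have lie_X : ∀ U : ∀ x : M, TangentSpace 𝓘(ℝ, E) x, lie X U x = -lie U X x := fun _ =>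
    VectorField.mlieBracket_swap_apply
  rw [lie_sub_smul_sub_smul (hV.mdifferentiableAt x) (hW.mdifferentiableAt x)
    (hβ.smooth_field.mdifferentiableAt x) (hβ.smooth_form.eval_mdifferentiableAt hV x)
    (hβ.smooth_form.eval_mdifferentiableAt hW x)]
  simp only [frobeniusForm, extDer, wedge, lieDer, lie_X, evalForm, map_sub, map_add, map_smul,
    map_neg, hβ.apply_eq_one, smul_eq_mul]
  ring

theorem isIntegrable_iff (hβ : IsDefiningCouple ξ β X) :
    IsIntegrable ξ ↔ ∀ V W : ∀ x : M, TangentSpace 𝓘(ℝ, E) x,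
      IsSmoothField V → IsSmoothField W → ∀ x, frobeniusForm X β V W x = 0 := by
  constructor
  · intro hξ V W hV hW x
    rw [hβ.frobeniusForm_eq hV hW, neg_eq_zero]
    exact hβ.apply_eq_zero_of_mem
      (hξ _ _ (hβ.isSection_sub_smul hV) (hβ.isSection_sub_smul hW) x)
  · intro hF V W hV hW x
    have hFVW := hF V W hV.1 hW.1 x
    rw [hβ.frobeniusForm_eq hV.1 hW.1, neg_eq_zero, hβ.sub_smul_eq_self hV.2,
      hβ.sub_smul_eq_self hW.2] at hFVW
    exact (hβ.ker_eq x).ge hFVW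

theorem maurerCartan_iff (hγ : IsDefiningCouple ξ γ X) (hα : IsZOne X α) (hξ : IsIntegrable ξ) :
    MaurerCartan γ X α ↔ IsIntegrable (LeviFlat.xiDef γ α) := by
  rw [(hγ.xiDef hα).isIntegrable_iff, MaurerCartan]
  refine forall₄_congr fun V W hV hW => forall_congr' fun x => ?_
  rw [delta_add_half_formBracket X hγ.smooth_form hα.smooth hV hW,
    hγ.isIntegrable_iff.1 hξ V W hV hW, sub_zero]

end IsDefiningCouple

end MaurerCartan

section Sections

variable {E : Type*} [NormedAddCommGroup E] [NormedSpace ℝ E]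
variable {M : Type*} [TopologicalSpace M] [ChartedSpace E M] [IsManifold 𝓘(ℝ, E) ∞ M]
variable {X : ∀ x : M, TangentSpace 𝓘(ℝ, E) x} {ξ : ∀ x : M, Submodule ℝ (TangentSpace 𝓘(ℝ, E) x)}
  {α γ : ∀ x : M, TangentSpace 𝓘(ℝ, E) x →L[ℝ] ℝ}
  {J S : ∀ x : M, Module.End ℝ (ξ x)} {Jα : ∀ x : M, Module.End ℝ (xiDef γ α x)}

/-- The space `𝓗(ξ)` of smooth vector fields tangent to `ξ`. -/
def sections (ξ : ∀ x : M, Submodule ℝ (TangentSpace 𝓘(ℝ, E) x)) :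
    Submodule ℝ (∀ x : M, TangentSpace 𝓘(ℝ, E) x) where
  carrier := {V | IsSection ξ V}
  add_mem' hV hW := ⟨hV.1.add hW.1, fun x => (ξ x).add_mem (hV.2 x) (hW.2 x)⟩
  zero_mem' := ⟨isSmoothField_zero, fun x => (ξ x).zero_mem⟩
  smul_mem' c _ hV := ⟨hV.1.const_smul c, fun x => (ξ x).smul_mem c (hV.2 x)⟩

/-- The algebra of smooth endomorphism fields of `ξ`. -/
def smoothEnd (ξ : ∀ x : M, Submodule ℝ (TangentSpace 𝓘(ℝ, E) x)) :
    Subalgebra ℝ (∀ x : M, Module.End ℝ (ξ x)) where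
  carrier := {A | IsSmoothEnd ξ A}
  mul_mem' {A B} hA hB V hV := by
    rw [act_mul A B hV.2]
    exact hA _ (hB V hV)
  add_mem' {A B} hA hB V hV := by
    rw [act_add_end A B hV.2]
    exact (sections ξ).add_mem (hA V hV) (hB V hV)
  algebraMap_mem' c V hV := by
    rw [Algebra.algebraMap_eq_smul_one, act_smul_end c 1 hV.2, act_one hV.2]
    exact (sections ξ).smul_mem c hV

/-- The action of smooth endomorphism fields on `𝓗(ξ)`, as a homomorphism of algebras. -/
def actHom (ξ : ∀ x : M, Submodule ℝ (TangentSpace 𝓘(ℝ, E) x)) :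
    smoothEnd ξ →ₐ[ℝ] Module.End ℝ (sections ξ) :=
  .ofLinearMap
    { toFun A :=
        { toFun V := ⟨act ξ A V, A.2 V V.2⟩
          map_add' V W := Subtype.ext (act_add A.1 V.2.2 W.2.2)
          map_smul' c V := Subtype.ext (act_smul A.1 (fun _ => c) V.2.2) }
      map_add' A B := LinearMap.ext fun V => Subtype.ext (act_add_end A.1 B.1 V.2.2)
      map_smul' c A := LinearMap.ext fun V => Subtype.ext (act_smul_end c A.1 V.2.2) }
    (LinearMap.ext fun V => Subtype.ext (act_one V.2.2))
    (fun A B => LinearMap.ext fun V => Subtype.ext (act_mul A.1 B.1 V.2.2))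

/-- The isomorphism `ω_α : 𝓗(ξ) → 𝓗(ξ_α)`. -/
def omegaSections (hγ : IsDefiningCouple ξ γ X) (hα : IsZOne X α) :
    sections ξ ≃ₗ[ℝ] sections (xiDef γ α) where
  toFun V := ⟨fun x => omega X α x (V.1 x),
    V.2.1.sub (hγ.smooth_field.smul (hα.smooth.eval V.2.1)),
    fun x => (omegaEquiv hγ hα x ⟨V.1 x, V.2.2 x⟩).2⟩
  invFun V := ⟨fun x => omegaInv X α x (V.1 x),
    V.2.1.add (hγ.smooth_field.smul (hα.smooth.eval V.2.1)),
    fun x => ((omegaEquiv hγ hα x).symm ⟨V.1 x, V.2.2 x⟩).2⟩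
  left_inv V := Subtype.ext <| funext fun x =>
    congrArg Subtype.val ((omegaEquiv hγ hα x).symm_apply_apply ⟨V.1 x, V.2.2 x⟩)
  right_inv V := Subtype.ext <| funext fun x =>
    congrArg Subtype.val ((omegaEquiv hγ hα x).apply_symm_apply ⟨V.1 x, V.2.2 x⟩)
  map_add' V W := Subtype.ext <| funext fun x =>
    congrArg Subtype.val ((omegaEquiv hγ hα x).map_add ⟨V.1 x, V.2.2 x⟩ ⟨W.1 x, W.2.2 x⟩)
  map_smul' c V := Subtype.ext <| funext fun x =>
    congrArg Subtype.val ((omegaEquiv hγ hα x).map_smul c ⟨V.1 x, V.2.2 x⟩)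

/-- The endomorphism field `ω_α⁻¹ J_α ω_α` of `ξ`. -/
def pullbackEnd (hγ : IsDefiningCouple ξ γ X) (hα : IsZOne X α)
    (Jα : ∀ x : M, Module.End ℝ (xiDef γ α x)) (x : M) : Module.End ℝ (ξ x) :=
  (omegaEquiv hγ hα x).symm.conj (Jα x)

theorem act_pullbackEnd (hγ : IsDefiningCouple ξ γ X) (hα : IsZOne X α)
    (hJα : IsSmoothEnd (xiDef γ α) Jα) (V : sections ξ) :
    act ξ (pullbackEnd hγ hα Jα) V =
      (omegaSections hγ hα).symm (actHom (xiDef γ α) ⟨Jα, hJα⟩ (omegaSections hγ hα V)) := by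
  funext x
  rw [act_apply _ (V.2.2 x)]
  exact congrArg (omegaInv X α x) (act_apply Jα ((omegaSections hγ hα V).2.2 x)).symm

theorem isSmoothEnd_pullbackEnd (hγ : IsDefiningCouple ξ γ X) (hα : IsZOne X α)
    (hJα : IsSmoothEnd (xiDef γ α) Jα) : IsSmoothEnd ξ (pullbackEnd hγ hα Jα) := fun V hV => by
  rw [act_pullbackEnd hγ hα hJα ⟨V, hV⟩]
  exact Subtype.property _

theorem Encodes.isDeformation {hγ : IsDefiningCouple ξ γ X} {hα : IsZOne X α}
    (hS : Encodes hγ hα J Jα S) (hJ : ∀ x (v : ξ x), J x (J x v) = -v) :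
    IsDeformation J S (pullbackEnd hγ hα Jα) where
  mul_self := funext fun x => LinearMap.ext (hJ x)
  anticomm := funext fun x => LinearMap.ext (hS.form01.2 x)
  isUnit_one_add := Pi.isUnit_iff.2 hS.isUnit
  conj := funext fun x => by
    rw [Pi.mul_apply, pullbackEnd, hS.conj_eq, mul_assoc, Pi.add_apply, Pi.one_apply,
      Ring.inverse_mul_cancel _ (hS.isUnit x), mul_one]
    rfl

theorem Encodes.isDeformation_actHom {hγ : IsDefiningCouple ξ γ X} {hα : IsZOne X α}
    (hS : Encodes hγ hα J Jα S) (hJ : IsComplexStructure ξ J) (hJα : IsSmoothEnd (xiDef γ α) Jα) :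
    IsDeformation (actHom ξ ⟨J, hJ.1⟩) (actHom ξ ⟨S, hS.form01.1⟩)
      (actHom ξ ⟨pullbackEnd hγ hα Jα, isSmoothEnd_pullbackEnd hγ hα hJα⟩) := by
  have two : IsUnit (2 : smoothEnd ξ) := by
    simpa only [map_ofNat] using (IsUnit.mk0 (2 : ℝ) two_ne_zero).map (algebraMap ℝ (smoothEnd ξ))
  have deformation : IsDeformation (R := smoothEnd ξ) ⟨J, hJ.1⟩ ⟨S, hS.form01.1⟩
      ⟨pullbackEnd hγ hα Jα, isSmoothEnd_pullbackEnd hγ hα hJα⟩ :=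
    .of_map_injective (f := (smoothEnd ξ).subtype) Subtype.val_injective two
      (hS.isDeformation hJ.2)
  exact deformation.map (R' := Module.End ℝ (sections ξ)) (actHom ξ).toRingHom

variable [CompleteSpace E]

/-- The Lie bracket on `𝓗(ξ)` for an integrable distribution `ξ`. -/
def lieSections (hξ : IsIntegrable ξ) : sections ξ →ₗ[ℝ] sections ξ →ₗ[ℝ] sections ξ :=
  have : IsManifold 𝓘(ℝ, E) 2 M := .of_le (n := ∞) (by norm_cast)
  LinearMap.mk₂ ℝ (fun V W => ⟨lie V.1 W.1, V.2.1.lie W.2.1, hξ _ _ V.2 W.2⟩)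
    (fun V V' _ => Subtype.ext <| funext fun x => VectorField.mlieBracket_add_left
      (V.2.1.mdifferentiableAt x) (V'.2.1.mdifferentiableAt x))
    (fun _ V _ => Subtype.ext <| funext fun x => VectorField.mlieBracket_const_smul_left
      (V.2.1.mdifferentiableAt x))
    (fun _ W W' => Subtype.ext <| funext fun x => VectorField.mlieBracket_add_right
      (W.2.1.mdifferentiableAt x) (W'.2.1.mdifferentiableAt x))
    (fun _ _ W => Subtype.ext <| funext fun x => VectorField.mlieBracket_const_smul_right
      (W.2.1.mdifferentiableAt x))

theorem lieSections_isAlt (hξ : IsIntegrable ξ) : (lieSections hξ).IsAlt := fun V =>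
  Subtype.ext (VectorField.mlieBracket_self (V := V.1))

/-- The deformed bracket `[·,·]_α` on `𝓗(ξ)`. -/
def lieDefSections (hγ : IsDefiningCouple ξ γ X) (hα : IsZOne X α)
    (h : IsIntegrable (xiDef γ α)) : sections ξ →ₗ[ℝ] sections ξ →ₗ[ℝ] sections ξ :=
  ((lieSections h).compl₁₂ (omegaSections hγ hα).toLinearMap
    (omegaSections hγ hα).toLinearMap).compr₂ (omegaSections hγ hα).symm.toLinearMap

theorem lieDefSections_isAlt (hγ : IsDefiningCouple ξ γ X) (hα : IsZOne X α)
    (h : IsIntegrable (xiDef γ α)) : (lieDefSections hγ hα h).IsAlt := fun V =>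
  (congrArg (omegaSections hγ hα).symm (lieSections_isAlt h (omegaSections hγ hα V))).trans
    (map_zero _)

theorem omegaSections_lieDefSections (hγ : IsDefiningCouple ξ γ X) (hα : IsZOne X α)
    (h : IsIntegrable (xiDef γ α)) (V W : sections ξ) :
    omegaSections hγ hα (lieDefSections hγ hα h V W) =
      lieSections h (omegaSections hγ hα V) (omegaSections hγ hα W) :=
  (omegaSections hγ hα).apply_symm_apply _

theorem omegaSections_nijenhuis (hγ : IsDefiningCouple ξ γ X) (hα : IsZOne X α)
    (hJα : IsSmoothEnd (xiDef γ α) Jα) (h : IsIntegrable (xiDef γ α)) (V W : sections ξ) :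
    omegaSections hγ hα (nijenhuis (lieDefSections hγ hα h · ·)
        (actHom ξ ⟨pullbackEnd hγ hα Jα, isSmoothEnd_pullbackEnd hγ hα hJα⟩) V W) =
      nijenhuis (lieSections h · ·) (actHom (xiDef γ α) ⟨Jα, hJα⟩)
        (omegaSections hγ hα V) (omegaSections hγ hα W) := by
  refine map_nijenhuis (omegaSections hγ hα) (omegaSections_lieDefSections hγ hα h)
    (fun V => ?_) V W
  rw [← LinearEquiv.eq_symm_apply]
  exact Subtype.ext (act_pullbackEnd hγ hα hJα V)

theorem nijenhuis_xiDef_eq_zero_iff {hγ : IsDefiningCouple ξ γ X} {hα : IsZOne X α}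
    (hS : Encodes hγ hα J Jα S) (hJ : IsComplexStructure ξ J) (hJα : IsSmoothEnd (xiDef γ α) Jα)
    (h : IsIntegrable (xiDef γ α)) :
    (∀ V W : ∀ x : M, TangentSpace 𝓘(ℝ, E) x, IsSection (xiDef γ α) V →
      IsSection (xiDef γ α) W → nijenhuis lie (act (xiDef γ α) Jα) V W = 0) ↔
    ∀ V W : ∀ x : M, TangentSpace 𝓘(ℝ, E) x, IsSection ξ V → IsSection ξ W →
      dbarOne (lieDef X α) (act ξ J) (act ξ S) V W
            + (1 / 2 : ℝ) • doubleBracket (lieDef X α) (act ξ J) (act ξ S) V W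
          = (1 / 4 : ℝ) • nijenhuis (lieDef X α) (act ξ J) V W := by
  have deformation_iff :=
    (hS.isDeformation_actHom hJ hJα).nijenhuis_eq_zero_iff (lieDefSections_isAlt hγ hα h)
  have transport : (∀ V W, nijenhuis (lieSections h · ·) (actHom (xiDef γ α) ⟨Jα, hJα⟩) V W = 0) ↔
      ∀ V W, nijenhuis (lieDefSections hγ hα h · ·)
        (actHom ξ ⟨pullbackEnd hγ hα Jα, isSmoothEnd_pullbackEnd hγ hα hJα⟩) V W = 0 := by
    rw [(omegaSections hγ hα).surjective.forall₂]
    refine forall₂_congr fun V W => ?_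
    rw [← omegaSections_nijenhuis, LinearEquiv.map_eq_zero_iff]
  have sections_iff := transport.trans deformation_iff
  exact ⟨fun H V W hV hW => congrArg Subtype.val
      (sections_iff.1 (fun V W => Subtype.ext (H V W V.2 W.2)) ⟨V, hV⟩ ⟨W, hW⟩),
    fun H V W hV hW => congrArg Subtype.val
      (sections_iff.2 (fun V W => Subtype.ext (H V W V.2 W.2)) ⟨V, hV⟩ ⟨W, hW⟩)⟩

end Sections

section Torsion

variable {E : Type*} [NormedAddCommGroup E] [NormedSpace ℝ E]
variable {M : Type*} [TopologicalSpace M] [ChartedSpace E M] [IsManifold 𝓘(ℝ, E) ∞ M]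
variable {V W X : ∀ x : M, TangentSpace 𝓘(ℝ, E) x}
  {ξ : ∀ x : M, Submodule ℝ (TangentSpace 𝓘(ℝ, E) x)} {J : ∀ x : M, Module.End ℝ (ξ x)}
  {α γ : ∀ x : M, TangentSpace 𝓘(ℝ, E) x →L[ℝ] ℝ}

theorem IsDefiningCouple.torsionT_mem (hγ : IsDefiningCouple ξ γ X)
    (V : ∀ x : M, TangentSpace 𝓘(ℝ, E) x) (x : M) : torsionT γ X V x ∈ ξ x :=
  hγ.sub_smul_mem x (lie V X x)

theorem act_formH (hγ : IsDefiningCouple ξ γ X) (hJ : ∀ x (v : ξ x), J x (J x v) = -v)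
    (V : ∀ x : M, TangentSpace 𝓘(ℝ, E) x) :
    act ξ J (formH ξ J γ X V) =
      (1 / 2 : ℝ) • (act ξ J (torsionT γ X V) - torsionT γ X (act ξ J V)) := by
  have hT := hγ.torsionT_mem V
  have hJT := act_mem J (hγ.torsionT_mem (act ξ J V))
  have hsum : ∀ x, (torsionT γ X V + act ξ J (torsionT γ X (act ξ J V))) x ∈ ξ x :=
    fun x => (ξ x).add_mem (hT x) (hJT x)
  have half : act ξ J (formH ξ J γ X V) =
      (1 / 2 : ℝ) • act ξ J (torsionT γ X V + act ξ J (torsionT γ X (act ξ J V))) :=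
    act_smul J (fun _ => 1 / 2) hsum
  rw [half, act_add J hT hJT, act_act_of_sq_eq_neg_one hJ (hγ.torsionT_mem _), sub_eq_add_neg]

theorem cmul_part01_formH (hγ : IsDefiningCouple ξ γ X)
    (hJ : ∀ x (v : ξ x), J x (J x v) = -v) (α : ∀ x : M, TangentSpace 𝓘(ℝ, E) x →L[ℝ] ℝ)
    (V W : ∀ x : M, TangentSpace 𝓘(ℝ, E) x) :
    cmul ξ J (part01 ξ J α V) (formH ξ J γ X W) = (1 / 4 : ℝ) •
      (evalForm α V • (torsionT γ X W + act ξ J (torsionT γ X (act ξ J W)))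
        + evalForm α (act ξ J V) • (act ξ J (torsionT γ X W) - torsionT γ X (act ξ J W))) := by
  funext x
  have re_part : (part01 ξ J α V x).re = 1 / 2 * evalForm α V x := by simp [part01]
  have im_part : (part01 ξ J α V x).im = 1 / 2 * evalForm α (act ξ J V) x := by simp [part01]
  rw [cmul, re_part, im_part, act_formH hγ hJ, formH]
  simp only [Pi.smul_apply, Pi.smul_apply', Pi.add_apply, Pi.sub_apply]
  module

variable [CompleteSpace E]

theorem lieDef_eq (hγ : IsDefiningCouple ξ γ X) (hα : IsZOne X α) (hξ : IsIntegrable ξ)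
    (hξα : IsIntegrable (xiDef γ α)) (hV : IsSection ξ V) (hW : IsSection ξ W) :
    lieDef X α V W =
      lie V W - evalForm α W • torsionT γ X V + evalForm α V • torsionT γ X W := by
  funext x
  set L := lie (V - evalForm α V • X) (W - evalForm α W • X) x with hL
  have L_tangent : γ x L + α x L = 0 :=
    hξα _ _ (omegaSections hγ hα ⟨V, hV⟩).2 (omegaSections hγ hα ⟨W, hW⟩).2 x
  have lieDef_eq_L : lieDef X α V W x = L - γ x L • X x := by
    change L + α x L • X x = _
    rw [eq_neg_of_add_eq_zero_right L_tangent, neg_smul, sub_eq_add_neg]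
  have lie_tangent : γ x (lie V W x) = 0 := hγ.apply_eq_zero_of_mem (hξ V W hV hW x)
  rw [lieDef_eq_L, hL, lie_sub_smul_sub_smul (hV.1.mdifferentiableAt x) (hW.1.mdifferentiableAt x)
    (hγ.smooth_field.mdifferentiableAt x) (hα.smooth.eval_mdifferentiableAt hV.1 x)
    (hα.smooth.eval_mdifferentiableAt hW.1 x)]
  simp only [torsionT, Pi.add_apply, Pi.sub_apply, Pi.smul_apply', map_sub, map_add, map_smul,
    lie_tangent, hγ.apply_eq_one, smul_eq_mul]
  module

theorem act_lieDef (hγ : IsDefiningCouple ξ γ X) (hα : IsZOne X α) (hξ : IsIntegrable ξ)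
    (hξα : IsIntegrable (xiDef γ α)) (hV : IsSection ξ V) (hW : IsSection ξ W) :
    act ξ J (lieDef X α V W) = act ξ J (lie V W) - evalForm α W • act ξ J (torsionT γ X V)
      + evalForm α V • act ξ J (torsionT γ X W) := by
  have smul_torsionT_mem : ∀ (f : M → ℝ) (U : ∀ x : M, TangentSpace 𝓘(ℝ, E) x) (x : M),
      (f • torsionT γ X U) x ∈ ξ x := fun f U x => (ξ x).smul_mem _ (hγ.torsionT_mem U x)
  have lie_sub_mem : ∀ x, (lie V W - evalForm α W • torsionT γ X V) x ∈ ξ x := fun x =>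
    (ξ x).sub_mem (hξ V W hV hW x) (smul_torsionT_mem _ V x)
  rw [lieDef_eq hγ hα hξ hξα hV hW, act_add J lie_sub_mem (smul_torsionT_mem _ W),
    act_sub J (hξ V W hV hW) (smul_torsionT_mem _ V), act_smul J _ (hγ.torsionT_mem V),
    act_smul J _ (hγ.torsionT_mem W)]

theorem nijenhuis_lieDef (hJ : IsComplexStructure ξ J) (hγ : IsDefiningCouple ξ γ X)
    (hα : IsZOne X α) (hξ : IsIntegrable ξ) (hξα : IsIntegrable (xiDef γ α))
    (hV : IsSection ξ V) (hW : IsSection ξ W) :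
    nijenhuis (lieDef X α) (act ξ J) V W =
      nijenhuis lie (act ξ J) V W - (4 : ℝ) • wedgeH ξ J γ X α V W := by
  have hJV := hJ.1 V hV
  have hJW := hJ.1 W hW
  rw [nijenhuis, act_lieDef hγ hα hξ hξα hJV hW,
    act_lieDef hγ hα hξ hξα hV hJW, lieDef_eq hγ hα hξ hξα hJV hJW,
    lieDef_eq hγ hα hξ hξα hV hW, nijenhuis, wedgeH, cmul_part01_formH hγ hJ.2,
    cmul_part01_formH hγ hJ.2]
  funext x
  simp only [Pi.add_apply, Pi.sub_apply, Pi.smul_apply, Pi.smul_apply']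
  module

theorem quarter_nijenhuis_lieDef (hξJ : IsLeviFlat ξ J) (hγ : IsDefiningCouple ξ γ X)
    (hα : IsZOne X α) (hξα : IsIntegrable (xiDef γ α)) (hV : IsSection ξ V) (hW : IsSection ξ W) :
    (1 / 4 : ℝ) • nijenhuis (lieDef X α) (act ξ J) V W = -wedgeH ξ J γ X α V W := by
  rw [nijenhuis_lieDef hξJ.complexStructure hγ hα hξJ.integrable hξα hV hW,
    hξJ.nijenhuis_eq_zero V W hV hW, zero_sub, smul_neg, smul_smul]
  norm_num

end Torsion

end LeviFlat

end

open LeviFlat in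
theorem mainTheorem4_general {E : Type*} [NormedAddCommGroup E] [NormedSpace ℝ E]
    [CompleteSpace E] {L : Type*} [TopologicalSpace L]
    [ChartedSpace E L] [IsManifold 𝓘(ℝ, E) ∞ L]
    (ξ : ∀ x : L, Submodule ℝ (TangentSpace 𝓘(ℝ, E) x))
    (J : ∀ x : L, Module.End ℝ (ξ x)) (hξJ : IsLeviFlat ξ J)
    (γ : ∀ x : L, TangentSpace 𝓘(ℝ, E) x →L[ℝ] ℝ)
    (X : ∀ x : L, TangentSpace 𝓘(ℝ, E) x) (hγ : IsDefiningCouple ξ γ X)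
    (α : ∀ x : L, TangentSpace 𝓘(ℝ, E) x →L[ℝ] ℝ) (hα : IsZOne X α)
    (Jα : ∀ x : L, Module.End ℝ (xiDef γ α x))
    (hJα : IsComplexStructure (xiDef γ α) Jα)
    (S : ∀ x : L, Module.End ℝ (ξ x)) (hS : Encodes hγ hα J Jα S) :
    IsLeviFlat (xiDef γ α) Jα ↔
      MaurerCartan γ X α ∧
      ∀ V W : ∀ x : L, TangentSpace 𝓘(ℝ, E) x, IsSection ξ V → IsSection ξ W →
        dbarOne (lieDef X α) (act ξ J) (act ξ S) V W
            + (1 / 2 : ℝ) • doubleBracket (lieDef X α) (act ξ J) (act ξ S) V W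
          = (1 / 4 : ℝ) • nijenhuis (lieDef X α) (act ξ J) V W ∧
        (1 / 4 : ℝ) • nijenhuis (lieDef X α) (act ξ J) V W = -wedgeH ξ J γ X α V W := by
  rw [hγ.maurerCartan_iff hα hξJ.integrable]
  constructor
  · intro h
    have deformation_eq := (nijenhuis_xiDef_eq_zero_iff hS hξJ.complexStructure hJα.1
      h.integrable).1 h.nijenhuis_eq_zero
    exact ⟨h.integrable, fun V W hV hW =>
      ⟨deformation_eq V W hV hW, quarter_nijenhuis_lieDef hξJ hγ hα h.integrable hV hW⟩⟩
  · rintro ⟨hξα, deformation_eq⟩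
    exact
      { codimOne := (hγ.xiDef hα).isCodimOne
        integrable := hξα
        complexStructure := hJα
        nijenhuis_eq_zero := (nijenhuis_xiDef_eq_zero_iff hS hξJ.complexStructure hJα.1 hξα).2
          fun V W hV hW => (deformation_eq V W hV hW).1 }

open LeviFlat in
theorem mainTheorem4 {E : Type*} [NormedAddCommGroup E] [NormedSpace ℝ E]
    [FiniteDimensional ℝ E] {L : Type*} [TopologicalSpace L] [T2Space L]
    [ChartedSpace E L] [IsManifold 𝓘(ℝ, E) ∞ L]
    (ξ : ∀ x : L, Submodule ℝ (TangentSpace 𝓘(ℝ, E) x))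
    (J : ∀ x : L, Module.End ℝ (ξ x)) (hξJ : IsLeviFlat ξ J)
    (γ : ∀ x : L, TangentSpace 𝓘(ℝ, E) x →L[ℝ] ℝ)
    (X : ∀ x : L, TangentSpace 𝓘(ℝ, E) x) (hγ : IsDefiningCouple ξ γ X)
    (α : ∀ x : L, TangentSpace 𝓘(ℝ, E) x →L[ℝ] ℝ) (hα : IsZOne X α)
    (Jα : ∀ x : L, Module.End ℝ (xiDef γ α x))
    (hJα : IsComplexStructure (xiDef γ α) Jα)
    (S : ∀ x : L, Module.End ℝ (ξ x)) (hS : Encodes hγ hα J Jα S) :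
    IsLeviFlat (xiDef γ α) Jα ↔
      MaurerCartan γ X α ∧
      ∀ V W : ∀ x : L, TangentSpace 𝓘(ℝ, E) x, IsSection ξ V → IsSection ξ W →
        dbarOne (lieDef X α) (act ξ J) (act ξ S) V W
            + (1 / 2 : ℝ) • doubleBracket (lieDef X α) (act ξ J) (act ξ S) V W
          = (1 / 4 : ℝ) • nijenhuis (lieDef X α) (act ξ J) V W ∧
        (1 / 4 : ℝ) • nijenhuis (lieDef X α) (act ξ J) V W = -wedgeH ξ J γ X α V W := by
  have : CompleteSpace E := FiniteDimensional.complete ℝ E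
  exact mainTheorem4_general ξ J hξJ γ X hγ α hα Jα hJα S hS
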